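/- Let $\mathcal V$ be a finite token vocabulary and let $\mathcal U$ be the infinite rooted tree whose nodes are the finite token sequences $v$, the children of $v$ being the sequences $vx$ with $x\in\mathcal V$. Each node $v$ carries a random probability distribution $\beta(\cdot\mid v)$ on $\mathcal V$, the next-token distribution of the target model after $v$. Assume that these distributions are i.i.d. over the nodes $v$, and that such a distribution is a point mass with probability strictly less than $1$. Let $$\mu=\mathbb E\Big[-\sum_{x\in\mathcal V}\beta(x\mid r)\log\beta(x\mid r)\Big]$$ be the expected entropy ($r$ is the root, $0\log 0=0$). Let $P(v)$ be the product of the edge weights $\beta$ along the path from $r$ to $v$, i.e. the probability that the target model generates $v$, and let $V(v)=-\log P(v)\in[0,\infty]$. For an integer $P\ge1$, a draft tree of capacity $P$ is a subtree of $\mathcal U$ that contains $r$ and has at most $P$ nodes. Given $\mathcal U$, the target model generates a random token sequence with these conditional probabilities, and the number of tokens obtained from a draft tree in one iteration is the number of nodes, including $r$, on its longest path from $r$ that agrees with the generated sequence. An optimal deterministic drafter knows $\mathcal U$ and chooses a draft tree of capacity $P$ that maximizes the conditional expectation of this number given $\mathcal U$. Let $X=X_P$ be the number of tokens obtained in one iteration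 by such a drafter, $\mathbb E[X_P]$ being taken over the verification and over $\mathcal U$, and let $T_P$ be the $P$-th smallest of the values $V(v)$, $v\in\mathcal U$, counted with multiplicity. Then, as $P\to\infty$, $$\mathbb E[X_P]=(1+o(1))\,\frac{\log P}{\mu}.$$ Moreover $\mathbb E[X_P]\ge \mathbb E[T_P]/\mu$ for every $P\ge1$, and there is a constant $C$ (which may depend on the law of $\beta$) such that $\mathbb E[T_P]\ge\log P-\log\log P-C$ for every $P\ge2$. -/

import Mathlib

/-- A realised token tree over the vocabulary `V`.  Its nodes are the finite token sequences
(`[]` is the root, i.e. the known prefix, and the children of `v` are the sequences `v ++ [x]`);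
`p v x` is the weight of the edge from `v` to `v ++ [x]`, the conditional probability that the
target model generates `x` after `v`. -/
abbrev TokenTree (V : Type*) [Fintype V] : Type _ := List V → stdSimplex ℝ V

/-- The acceptance probability `P(v)` of a node: the product of the edge weights on the path from
the root to `v` (`fun u => p (x :: u)` is the subtree hanging at the first token `x`). -/
def nodeProb {V : Type*} [Fintype V] : TokenTree V → List V → ℝ
  | _, [] => 1
  | p, x :: v => (p []).1 x * nodeProb (fun u => p (x :: u)) v

/-- The defining recursion of `P(v)` along the edges of the tree. -/
theorem nodeProb_append_singleton {V : Type*} [Fintype V] (p : TokenTree V) (v : List V) (x : V) :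
    nodeProb p (v ++ [x]) = nodeProb p v * (p v).1 x := by
  induction v generalizing p with
  | nil => simp [nodeProb]
  | cons y v ih => simp [nodeProb, ih, mul_assoc]

/-- A draft tree of capacity `P`: a subtree containing the root, with at most `P` nodes. -/
structure IsDraftTree {V : Type*} (P : ℕ) (T : Finset (List V)) : Prop where
  root_mem : [] ∈ T
  parent_mem : ∀ (v : List V) (x : V), v ++ [x] ∈ T → v ∈ T
  card_le : T.card ≤ P

/-- The number of nodes (root included) on the longest accepted path of `T`, when the target model
generates the token sequence `w`: the nodes accepted are those that are prefixes of `w`. -/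
def acceptedLength {V : Type*} [DecidableEq V] (T : Finset (List V)) (w : List V) : ℕ :=
  (T.filter (fun v => v <+: w)).sup (fun v => v.length + 1)

/-- The expected number of tokens obtained in one iteration from the draft tree `T`, for a fixed
token tree `p`.  The expectation is over the randomness of the verification: the target model
generates `w` with probability `P(w)`, and only as many tokens as `T` is deep can matter. -/
noncomputable def expectedAccepted {V : Type*} [Fintype V] [DecidableEq V]
    (p : TokenTree V) (T : Finset (List V)) : ℝ :=
  ∑ w : Fin (T.sup List.length) → V,
    nodeProb p (List.ofFn w) * (acceptedLength T (List.ofFn w) : ℝ)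

/-- `D` is an optimal deterministic drafter of capacity `P`: knowing the whole token tree, it
answers with a draft tree of maximal expected accepted length. -/
def IsOptimalDrafter {V : Type*} [Fintype V] [DecidableEq V] (P : ℕ)
    (D : TokenTree V → Finset (List V)) : Prop :=
  ∀ p : TokenTree V, IsDraftTree P (D p) ∧
    ∀ T : Finset (List V), IsDraftTree P T → expectedAccepted p T ≤ expectedAccepted p (D p)

/-- `N(t)`, the number of nodes `v` of value `-log P(v) ≤ t` (nodes with `P(v) = 0` have value
`+∞` and are never counted). -/
noncomputable def nodeCount {V : Type*} [Fintype V] (p : TokenTree V) (t : ℝ) : ℕ∞ :=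
  {v : List V | 0 < nodeProb p v ∧ -Real.log (nodeProb p v) ≤ t}.encard

/-- `T_P`, the `P`-th smallest node value (`P ≥ 1`), counted with multiplicity. -/
noncomputable def kthValue {V : Type*} [Fintype V] (P : ℕ) (p : TokenTree V) : ℝ :=
  sInf {t : ℝ | (P : ℕ∞) ≤ nodeCount p t}

/-- The next-token distributions at the different nodes are i.i.d., and with positive probability
such a distribution is not a point mass. -/
structure IsIIDTokenTree {V Ω : Type*} [Fintype V] [MeasurableSpace Ω]
    (ℙ : MeasureTheory.Measure Ω) (β : List V → Ω → stdSimplex ℝ V) : Prop where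
  measurable : ∀ v, Measurable (β v)
  indep : ProbabilityTheory.iIndepFun β ℙ
  identDistrib : ∀ v, ProbabilityTheory.IdentDistrib (β v) (β []) ℙ ℙ
  not_pointMass : ℙ {ω | ∃ x, (β [] ω).1 x = 1} < 1

/-- `μ`, the expected entropy of a next-token distribution. -/
noncomputable def expectedEntropy {V Ω : Type*} [Fintype V] [MeasurableSpace Ω]
    (ℙ : MeasureTheory.Measure Ω) (β : List V → Ω → stdSimplex ℝ V) : ℝ :=
  ∫ ω, -∑ x, (β [] ω).1 x * Real.log ((β [] ω).1 x) ∂ℙ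

/-- `E[X]` for the drafter `D`: the expected number of tokens per iteration, over both the
verification and the random token tree. -/
noncomputable def expectedTokens {V Ω : Type*} [Fintype V] [DecidableEq V] [MeasurableSpace Ω]
    (ℙ : MeasureTheory.Measure Ω) (β : List V → Ω → stdSimplex ℝ V)
    (D : TokenTree V → Finset (List V)) : ℝ :=
  ∫ ω, expectedAccepted (fun v => β v ω) (D (fun v => β v ω)) ∂ℙ

/-! By linearity, the expected accepted length of a draft tree is the sum of $P(v)$ over its nodes.
Since $P$ decreases along paths, a tree grown greedily is optimal, and $T_P$ is the largest value on
it.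

Lower bound: the generated sequence leaves the greedy tree through one boundary node, and every
boundary node of positive probability has value at least $T_P$. So $T_P$ is at most the entropy of
the exit node, which by the chain rule is the sum of $P(v)H(\beta(\cdot\mid v))$ over the tree
(`kthValue_le_sum`). Whether $v$ is in the tree does not depend on the distribution at $v$
(`mem_greedyTree_update`), so a Wald identity gives $E[T_P]\le\mu E[X_P]$.

The other estimates rest on $m(s)=E\sum_x\beta(x)^s$: the sum of $P(v)^s$ over level $k$ has mean
$m(s)^k$, and $m(1+\theta)\le 1-\theta\mu+O(\theta^2)$. Taking $\theta$ of order $1/\log P$ bounds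
$E[T_P]$ from below; the factor $1/(1-m(1+\theta))=O(\log P)$ costs the $\log\log P$. For the upper
bound on $E[X_P]$, levels above depth about $(\log P)/a$, $a<\mu$, contribute at most 1 each, and
with $\theta$ fixed the deeper ones contribute $O(1)$. -/

section TokenTree

open Finset

variable {V : Type*} [Fintype V]

/-! ### Acceptance probabilities -/

theorem nodeProb_nonneg (p : TokenTree V) (v : List V) : 0 ≤ nodeProb p v := by
  induction v generalizing p with
  | nil => simp [nodeProb]
  | cons x v ih => exact mul_nonneg ((p []).2.1 x) (ih _)

theorem stdSimplex_apply_le_one (b : stdSimplex ℝ V) (x : V) : b.1 x ≤ 1 := by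
  rw [← b.2.2]
  exact Finset.single_le_sum (fun y _ => b.2.1 y) (Finset.mem_univ x)

theorem nodeProb_append_le (p : TokenTree V) (v : List V) (x : V) :
    nodeProb p (v ++ [x]) ≤ nodeProb p v := by
  rw [nodeProb_append_singleton]
  exact mul_le_of_le_one_right (nodeProb_nonneg p v) (stdSimplex_apply_le_one _ x)

theorem nodeProb_le_one (p : TokenTree V) (v : List V) : nodeProb p v ≤ 1 := by
  induction v using List.reverseRecOn with
  | nil => simp [nodeProb]
  | append_singleton v x ih => exact (nodeProb_append_le p v x).trans ih

theorem sum_nodeProb_append (p : TokenTree V) (v : List V) :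
    ∑ x, nodeProb p (v ++ [x]) = nodeProb p v := by
  simp_rw [nodeProb_append_singleton, ← Finset.mul_sum]
  rw [(p v).2.2, mul_one]

/-- The acceptance probability of a node depends only on its strict ancestors. -/
theorem nodeProb_congr {p q : TokenTree V} {v : List V}
    (h : ∀ u, u <+: v → u ≠ v → p u = q u) : nodeProb p v = nodeProb q v := by
  induction v using List.reverseRecOn with
  | nil => simp [nodeProb]
  | append_singleton v x ih =>
    rw [nodeProb_append_singleton, nodeProb_append_singleton,
      h v (List.prefix_append v [x]) (by simp), ih]
    intro u hu _
    refine h u (hu.trans (List.prefix_append v [x])) fun h' => ?_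
    have := hu.length_le
    simp [h'] at this

variable [DecidableEq V]

theorem sum_nodeProb_ofFn_of_prefix (n : ℕ) (p : TokenTree V) (v : List V) (hv : v.length ≤ n) :
    ∑ w : Fin n → V, (if v <+: List.ofFn w then nodeProb p (List.ofFn w) else 0) =
      nodeProb p v := by
  induction n generalizing p v with
  | zero =>
    obtain rfl : v = [] := List.length_eq_zero_iff.1 (by omega)
    simp [nodeProb]
  | succ n ih =>
    rw [← (Fin.consEquiv (fun _ : Fin (n + 1) => V)).sum_comp, Fintype.sum_prod_type]
    cases v with
    | nil =>
      have h (x : V) := ih (fun u => p (x :: u)) [] (by simp)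
      simp only [List.nil_prefix, if_true] at h
      simp [Fin.consEquiv, List.ofFn_succ, nodeProb, ← Finset.mul_sum, h, (p []).2.2]
    | cons y v =>
      have h := ih (fun u => p (y :: u)) v (by simpa using hv)
      simp only [Fin.consEquiv, Equiv.coe_fn_mk, List.ofFn_succ, Fin.cons_zero, Fin.cons_succ,
        nodeProb, List.cons_prefix_cons]
      rw [Finset.sum_eq_single y]
      · simp only [true_and]
        rw [← h, Finset.mul_sum]
        exact Finset.sum_congr rfl fun w _ => by split_ifs <;> simp
      · intro x _ hx
        simp [hx.symm]
      · simp

/-! ### Draft trees -/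

omit [Fintype V] [DecidableEq V] in
theorem IsDraftTree.prefix_mem {P : ℕ} {T : Finset (List V)} (hT : IsDraftTree P T)
    {u v : List V} (huv : u <+: v) (hv : v ∈ T) : u ∈ T := by
  induction v using List.reverseRecOn with
  | nil => simpa [List.prefix_nil.1 huv] using hv
  | append_singleton v x ih =>
    rcases List.prefix_concat_iff.1 huv with h | h
    · simpa [h] using hv
    · exact ih h (hT.parent_mem v x hv)

omit [Fintype V] in
-- Prefixes of `w` are determined by their length, and `T` is closed under prefixes, so the accepted
-- nodes have lengths filling an initial segment.
theorem acceptedLength_eq_card {P : ℕ} {T : Finset (List V)} (hT : IsDraftTree P T)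
    (w : List V) : acceptedLength T w = #{v ∈ T | v <+: w} := by
  have hinj : Set.InjOn List.length (({v ∈ T | v <+: w} : Finset (List V)) : Set (List V)) := by
    intro u hu v hv h
    simp only [coe_filter, Set.mem_ofPred_eq] at hu hv
    exact (List.prefix_of_prefix_length_le hu.2 hv.2 h.le).eq_of_length h
  have himage : ({v ∈ T | v <+: w} : Finset (List V)).image List.length =
      range (acceptedLength T w) := by
    ext k
    simp only [mem_image, mem_filter, mem_range, acceptedLength, Finset.lt_sup_iff]
    constructor
    · rintro ⟨v, hv, rfl⟩
      exact ⟨v, hv, Nat.lt_succ_self _⟩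
    · rintro ⟨v, hv, hk⟩
      exact ⟨v.take k, ⟨hT.prefix_mem (List.take_prefix k v) hv.1,
        (List.take_prefix k v).trans hv.2⟩, by simp; omega⟩
  rw [← Finset.card_image_of_injOn hinj, himage, card_range]

/-- The expected accepted length of a draft tree is the sum of its acceptance probabilities. -/
theorem expectedAccepted_eq_sum {P : ℕ} {T : Finset (List V)} (hT : IsDraftTree P T)
    (p : TokenTree V) : expectedAccepted p T = ∑ v ∈ T, nodeProb p v := by
  simp_rw [expectedAccepted, acceptedLength_eq_card hT, Finset.card_filter, Nat.cast_sum,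
    Finset.mul_sum]
  rw [Finset.sum_comm]
  refine Finset.sum_congr rfl fun v hv => ?_
  rw [← sum_nodeProb_ofFn_of_prefix (T.sup List.length) p v (Finset.le_sup (f := List.length) hv)]
  refine Finset.sum_congr rfl fun w _ => ?_
  split_ifs <;> simp

/-! ### Levels and boundaries -/

/-- The children of the nodes of `S`. -/
def childNodes (S : Finset (List V)) : Finset (List V) :=
  (S ×ˢ (univ : Finset V)).image fun a => a.1 ++ [a.2]

theorem append_mem_childNodes {S : Finset (List V)} {v : List V} {x : V} :
    v ++ [x] ∈ childNodes S ↔ v ∈ S := by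
  simp [childNodes]

theorem exists_of_mem_childNodes {S : Finset (List V)} {u : List V} (hu : u ∈ childNodes S) :
    ∃ v ∈ S, ∃ x, u = v ++ [x] := by
  simp only [childNodes, mem_image, mem_product, mem_univ, and_true, Prod.exists] at hu
  obtain ⟨v, x, hv, rfl⟩ := hu
  exact ⟨v, hv, x, rfl⟩

theorem sum_childNodes (S : Finset (List V)) (f : List V → ℝ) :
    ∑ u ∈ childNodes S, f u = ∑ v ∈ S, ∑ x, f (v ++ [x]) := by
  rw [childNodes, Finset.sum_image, Finset.sum_product]
  rintro ⟨u, x⟩ _ ⟨v, y⟩ _ h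
  simpa using List.append_inj' h rfl

/-- The nodes of length `n`. -/
def treeLevel (V : Type*) [Fintype V] [DecidableEq V] : ℕ → Finset (List V)
  | 0 => {[]}
  | n + 1 => childNodes (treeLevel V n)

theorem mem_treeLevel {n : ℕ} {v : List V} : v ∈ treeLevel V n ↔ v.length = n := by
  induction v using List.reverseRecOn generalizing n with
  | nil =>
    cases n with
    | zero => simp [treeLevel]
    | succ n =>
      simp only [treeLevel, List.length_nil, (Nat.succ_ne_zero n).symm, iff_false]
      intro h
      obtain ⟨v, _, x, h⟩ := exists_of_mem_childNodes h
      simp at h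
  | append_singleton v x ih =>
    cases n with
    | zero => simp [treeLevel]
    | succ n => simp [treeLevel, append_mem_childNodes, ih]

/-- The nodes outside `S` whose parent lies in `S`. -/
def treeBoundary (S : Finset (List V)) : Finset (List V) := childNodes S \ S

/-- The children of nodes of `T` are the boundary together with the non-root nodes of `T`; the sum
telescopes. -/
theorem sum_treeBoundary {P : ℕ} {T : Finset (List V)} (hT : IsDraftTree P T) (f : List V → ℝ) :
    ∑ u ∈ treeBoundary T, f u = f [] + ∑ v ∈ T, (∑ x, f (v ++ [x]) - f v) := by
  have hunion : childNodes T = treeBoundary T ∪ T.erase [] := by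
    ext u
    induction u using List.reverseRecOn with
    | nil =>
      have : ([] : List V) ∉ childNodes T := fun h => by
        obtain ⟨v, _, x, h⟩ := exists_of_mem_childNodes h
        simp at h
      simp [treeBoundary, this]
    | append_singleton v x _ =>
      have := hT.parent_mem v x
      simp only [treeBoundary, mem_union, mem_sdiff, append_mem_childNodes, mem_erase]
      simp
      tauto
  have hdisj : Disjoint (treeBoundary T) (T.erase []) := by
    rw [Finset.disjoint_left]
    intro u hu hu'
    exact (mem_sdiff.1 hu).2 (mem_of_mem_erase hu')
  have h := sum_childNodes T f
  rw [hunion, Finset.sum_union hdisj] at h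
  have h' := Finset.add_sum_erase T f hT.root_mem
  rw [Finset.sum_sub_distrib]
  linarith

theorem sum_treeBoundary_nodeProb {P : ℕ} {T : Finset (List V)} (hT : IsDraftTree P T)
    (p : TokenTree V) : ∑ u ∈ treeBoundary T, nodeProb p u = 1 := by
  rw [sum_treeBoundary hT]
  simp [sum_nodeProb_append, nodeProb]

/-- The entropy of a distribution on the vocabulary. -/
noncomputable def simplexEntropy (b : stdSimplex ℝ V) : ℝ := ∑ x, Real.negMulLog (b.1 x)

/-- Chain rule for the entropy of the node through which the generated sequence leaves `T`. -/
theorem sum_treeBoundary_negMulLog {P : ℕ} {T : Finset (List V)} (hT : IsDraftTree P T)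
    (p : TokenTree V) : ∑ u ∈ treeBoundary T, Real.negMulLog (nodeProb p u) =
      ∑ v ∈ T, nodeProb p v * simplexEntropy (p v) := by
  rw [sum_treeBoundary hT]
  simp only [nodeProb, Real.negMulLog_one, zero_add]
  refine Finset.sum_congr rfl fun v _ => ?_
  simp_rw [nodeProb_append_singleton, Real.negMulLog_mul, Finset.sum_add_distrib,
    ← Finset.sum_mul, ← Finset.mul_sum, (p v).2.2, simplexEntropy]
  ring

theorem nodeProb_congr_of_mem_treeBoundary {P : ℕ} {T : Finset (List V)} (hT : IsDraftTree P T)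
    {p q : TokenTree V} (hpq : ∀ v ∈ T, p v = q v) {u : List V} (hu : u ∈ treeBoundary T) :
    nodeProb p u = nodeProb q u := by
  obtain ⟨v, hv, x, rfl⟩ := exists_of_mem_childNodes (mem_sdiff.1 hu).1
  refine nodeProb_congr fun w hw hne => hpq w ?_
  rcases List.prefix_concat_iff.1 hw with h | h
  · exact absurd h hne
  · exact hT.prefix_mem h hv

/-! ### The greedy tree -/

/-- The most probable nodes of the boundary of `S`. -/
noncomputable def boundaryMaximizers (p : TokenTree V) (S : Finset (List V)) :
    Finset (List V) :=
  {v ∈ treeBoundary S | ∀ u ∈ treeBoundary S, nodeProb p u ≤ nodeProb p v}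

open Classical in
/-- A choice of an element in every nonempty finite set of nodes. -/
noncomputable def pickNode (M : Finset (List V)) : List V :=
  -- The choice depends on the set `M` alone, so ties are broken alike in any two token trees with
  -- the same maximizers.
  if h : M.Nonempty then h.choose else []

/-- The tree with `n + 1` nodes obtained from the root by adding repeatedly a most probable node
of the boundary. -/
noncomputable def greedyTree (p : TokenTree V) : ℕ → Finset (List V)
  | 0 => {[]}
  | n + 1 => insert (pickNode (boundaryMaximizers p (greedyTree p n))) (greedyTree p n)

theorem pickNode_boundaryMaximizers_spec {P : ℕ} {T : Finset (List V)} (hT : IsDraftTree P T)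
    (p : TokenTree V) :
    pickNode (boundaryMaximizers p T) ∈ treeBoundary T ∧
      (∀ u ∈ treeBoundary T, nodeProb p u ≤ nodeProb p (pickNode (boundaryMaximizers p T))) ∧
      0 < nodeProb p (pickNode (boundaryMaximizers p T)) := by
  have hex : ∃ u ∈ treeBoundary T, 0 < nodeProb p u := by
    by_contra! h
    have := Finset.sum_nonpos h
    rw [sum_treeBoundary_nodeProb hT] at this
    linarith
  obtain ⟨u, hu, hpos⟩ := hex
  have hne : (boundaryMaximizers p T).Nonempty := by
    obtain ⟨v, hv, hmax⟩ := Finset.exists_max_image (treeBoundary T) (nodeProb p) ⟨u, hu⟩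
    exact ⟨v, mem_filter.2 ⟨hv, hmax⟩⟩
  have hmem : pickNode (boundaryMaximizers p T) ∈ boundaryMaximizers p T := by
    rw [pickNode, dif_pos hne]
    exact hne.choose_spec
  have hmem' := mem_filter.1 hmem
  exact ⟨hmem'.1, hmem'.2, hpos.trans_le (hmem'.2 u hu)⟩

theorem isDraftTree_greedyTree (p : TokenTree V) (n : ℕ) :
    IsDraftTree (n + 1) (greedyTree p n) := by
  induction n with
  | zero => exact ⟨by simp [greedyTree], by simp [greedyTree], by simp [greedyTree]⟩
  | succ n ih =>
    refine ⟨mem_insert_of_mem ih.root_mem, fun v x h => ?_, ?_⟩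
    · rcases mem_insert.1 h with h | h
      · have hb := (pickNode_boundaryMaximizers_spec ih p).1
        rw [← h] at hb
        exact mem_insert_of_mem (append_mem_childNodes.1 (mem_sdiff.1 hb).1)
      · exact mem_insert_of_mem (ih.parent_mem v x h)
    · exact (card_insert_le _ _).trans (Nat.succ_le_succ ih.card_le)

theorem card_greedyTree (p : TokenTree V) (n : ℕ) : #(greedyTree p n) = n + 1 := by
  induction n with
  | zero => simp [greedyTree]
  | succ n ih =>
    rw [greedyTree, card_insert_of_notMem, ih]
    exact (mem_sdiff.1 (pickNode_boundaryMaximizers_spec (isDraftTree_greedyTree p n) p).1).2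

theorem length_le_of_mem_greedyTree (p : TokenTree V) (n : ℕ) {v : List V}
    (hv : v ∈ greedyTree p n) : v.length ≤ n := by
  induction n generalizing v with
  | zero => simp_all [greedyTree]
  | succ n ih =>
    rcases mem_insert.1 hv with rfl | h
    · obtain ⟨v, hv, x, h⟩ := exists_of_mem_childNodes (mem_sdiff.1
        (pickNode_boundaryMaximizers_spec (isDraftTree_greedyTree p n) p).1).1
      rw [h]
      simpa using ih hv
    · exact (ih h).trans (Nat.le_succ n)

theorem nodeProb_pos_of_mem_greedyTree (p : TokenTree V) (n : ℕ) {v : List V}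
    (hv : v ∈ greedyTree p n) : 0 < nodeProb p v := by
  induction n generalizing v with
  | zero => simp_all [greedyTree, nodeProb]
  | succ n ih =>
    rcases mem_insert.1 hv with rfl | h
    · exact (pickNode_boundaryMaximizers_spec (isDraftTree_greedyTree p n) p).2.2
    · exact ih h

/-- Invariant of the growth: the added node was maximal on the old boundary, and a new boundary node
is either an old one or a child of the added node. -/
theorem nodeProb_le_of_mem_treeBoundary_greedyTree (p : TokenTree V) (n : ℕ) {u v : List V}
    (hu : u ∈ treeBoundary (greedyTree p n)) (hv : v ∈ greedyTree p n) :
    nodeProb p u ≤ nodeProb p v := by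
  induction n generalizing u v with
  | zero =>
    obtain rfl : v = [] := by simpa [greedyTree] using hv
    exact nodeProb_le_one p u
  | succ n ih =>
    obtain ⟨hb, hmax, _⟩ := pickNode_boundaryMaximizers_spec (isDraftTree_greedyTree p n) p
    have hle : nodeProb p (pickNode (boundaryMaximizers p (greedyTree p n))) ≤ nodeProb p v := by
      rcases mem_insert.1 hv with h | h
      · rw [h]
      · exact ih hb h
    refine le_trans ?_ hle
    obtain ⟨hc, hn⟩ := mem_sdiff.1 hu
    obtain ⟨w, hw, x, rfl⟩ := exists_of_mem_childNodes hc
    rcases mem_insert.1 hw with h | h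
    · rw [← h]
      exact nodeProb_append_le p w x
    · exact hmax _ (mem_sdiff.2 ⟨append_mem_childNodes.2 h, fun h' => hn (mem_insert_of_mem h')⟩)

theorem nodeProb_le_of_notMem_greedyTree (p : TokenTree V) (n : ℕ) {u v : List V}
    (hu : u ∉ greedyTree p n) (hv : v ∈ greedyTree p n) : nodeProb p u ≤ nodeProb p v := by
  induction u using List.reverseRecOn with
  | nil => exact absurd (isDraftTree_greedyTree p n).root_mem hu
  | append_singleton u x ih =>
    by_cases h : u ∈ greedyTree p n
    · exact nodeProb_le_of_mem_treeBoundary_greedyTree p n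
        (mem_sdiff.2 ⟨append_mem_childNodes.2 h, hu⟩) hv
    · exact (nodeProb_append_le p u x).trans (ih h)

/-- Exchange argument: the least probability in `G` separates `T \ G` from `G \ T`, and the latter
is at least as large. -/
theorem sum_nodeProb_le_greedyTree (p : TokenTree V) (n : ℕ) {T : Finset (List V)}
    (hT : #T ≤ n + 1) : ∑ v ∈ T, nodeProb p v ≤ ∑ v ∈ greedyTree p n, nodeProb p v := by
  set G := greedyTree p n
  obtain ⟨m, hm, hmin⟩ := Finset.exists_min_image G (nodeProb p)
    ⟨[], (isDraftTree_greedyTree p n).root_mem⟩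
  have hcard : #(T \ G) ≤ #(G \ T) := by
    have h1 := Finset.card_sdiff_add_card_inter T G
    have h2 := Finset.card_sdiff_add_card_inter G T
    rw [Finset.inter_comm] at h2
    have h3 : #G = n + 1 := card_greedyTree p n
    omega
  have h1 : ∑ v ∈ T \ G, nodeProb p v ≤ #(T \ G) • nodeProb p m :=
    Finset.sum_le_card_nsmul _ _ _ fun u hu =>
      nodeProb_le_of_notMem_greedyTree p n (mem_sdiff.1 hu).2 hm
  have h2 : #(G \ T) • nodeProb p m ≤ ∑ v ∈ G \ T, nodeProb p v :=
    Finset.card_nsmul_le_sum _ _ _ fun u hu => hmin u (mem_sdiff.1 hu).1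
  have h3 := nsmul_le_nsmul_left (nodeProb_nonneg p m) hcard
  rw [← Finset.sum_inter_add_sum_sdiff T G, ← Finset.sum_inter_add_sum_sdiff G T,
    Finset.inter_comm G T]
  linarith

/-- The greedy tree is an optimal draft tree. -/
theorem expectedAccepted_optimal {P : ℕ} {D : TokenTree V → Finset (List V)}
    (hD : IsOptimalDrafter (P + 1) D) (p : TokenTree V) :
    expectedAccepted p (D p) = ∑ v ∈ greedyTree p P, nodeProb p v := by
  obtain ⟨h1, h2⟩ := hD p
  have h3 := h2 _ (isDraftTree_greedyTree p P)
  rw [expectedAccepted_eq_sum (isDraftTree_greedyTree p P)] at h3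
  refine le_antisymm ?_ h3
  rw [expectedAccepted_eq_sum h1]
  exact sum_nodeProb_le_greedyTree p P h1.card_le

/-- Whether the greedy tree contains `v` does not depend on the distribution at `v`. -/
theorem mem_greedyTree_update (p : TokenTree V) (v : List V) (b : stdSimplex ℝ V) (n : ℕ) :
    v ∈ greedyTree (Function.update p v b) n ↔ v ∈ greedyTree p n := by
  -- Until `v` is added, only distributions at nodes other than `v` are consulted, so both growths
  -- coincide; once added, `v` stays.
  have key : (v ∉ greedyTree p n ∧ greedyTree (Function.update p v b) n = greedyTree p n) ∨
      (v ∈ greedyTree p n ∧ v ∈ greedyTree (Function.update p v b) n) := by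
    induction n with
    | zero => simp only [greedyTree]; tauto
    | succ n ih =>
      rcases ih with ⟨hv, heq⟩ | ⟨h1, h2⟩
      · have : greedyTree (Function.update p v b) (n + 1) = greedyTree p (n + 1) := by
          have hcongr (u) (hu : u ∈ treeBoundary (greedyTree p n)) :
              nodeProb (Function.update p v b) u = nodeProb p u :=
            nodeProb_congr_of_mem_treeBoundary (isDraftTree_greedyTree p n)
              (fun w hw => Function.update_of_ne (ne_of_mem_of_not_mem hw hv) _ _) hu
          have hmax : boundaryMaximizers (Function.update p v b) (greedyTree p n) =
              boundaryMaximizers p (greedyTree p n) := by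
            refine Finset.filter_congr fun w hw => ?_
            refine forall₂_congr fun u hu => ?_
            rw [hcongr u hu, hcongr w hw]
          rw [greedyTree, greedyTree, heq, hmax]
        rw [this]
        tauto
      · exact Or.inr ⟨mem_insert_of_mem h1, mem_insert_of_mem h2⟩
  rcases key with ⟨_, h⟩ | h
  · rw [h]
  · tauto

theorem nodeProb_update (p : TokenTree V) (v : List V) (b : stdSimplex ℝ V) :
    nodeProb (Function.update p v b) v = nodeProb p v :=
  nodeProb_congr fun _ _ h => Function.update_of_ne h _ _

/-! ### The order statistics of the node values -/

omit [DecidableEq V] in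
theorem zero_le_of_le_nodeCount {p : TokenTree V} {n : ℕ} {t : ℝ}
    (ht : ((n + 1 : ℕ) : ℕ∞) ≤ nodeCount p t) : 0 ≤ t := by
  have : nodeCount p t ≠ 0 := by
    intro h
    simp [h] at ht
  obtain ⟨v, _, hv⟩ := Set.encard_ne_zero.1 this
  exact (neg_nonneg.2 (Real.log_nonpos (nodeProb_nonneg p v) (nodeProb_le_one p v))).trans hv

omit [DecidableEq V] in
theorem bddBelow_setOf_le_nodeCount (p : TokenTree V) (n : ℕ) :
    BddBelow {t : ℝ | ((n + 1 : ℕ) : ℕ∞) ≤ nodeCount p t} :=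
  ⟨0, fun _ => zero_le_of_le_nodeCount⟩

theorem le_nodeCount_of_forall_greedyTree {p : TokenTree V} {n : ℕ} {t : ℝ}
    (ht : ∀ v ∈ greedyTree p n, -Real.log (nodeProb p v) ≤ t) :
    ((n + 1 : ℕ) : ℕ∞) ≤ nodeCount p t := by
  rw [← card_greedyTree p n, ← Set.encard_coe_eq_coe_finsetCard]
  exact Set.encard_le_encard fun v hv =>
    ⟨nodeProb_pos_of_mem_greedyTree p n hv, ht v hv⟩

/-- Otherwise all nodes of value at most `t` would lie in the greedy tree without `v`, which has
only `n` nodes. -/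
theorem le_of_le_nodeCount {p : TokenTree V} {n : ℕ} {t : ℝ}
    (ht : ((n + 1 : ℕ) : ℕ∞) ≤ nodeCount p t) {v : List V} (hv : v ∈ greedyTree p n) :
    -Real.log (nodeProb p v) ≤ t := by
  by_contra! hlt
  have hsub : {v : List V | 0 < nodeProb p v ∧ -Real.log (nodeProb p v) ≤ t} ⊆
      ((greedyTree p n).erase v : Finset (List V)) := by
    rintro u ⟨hpos, hu⟩
    have hpv := nodeProb_pos_of_mem_greedyTree p n hv
    simp only [coe_erase, Set.mem_sdiff, mem_coe, Set.mem_singleton_iff]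
    refine ⟨?_, fun h => by rw [h] at hu; linarith⟩
    by_contra hmem
    have := Real.log_le_log hpos (nodeProb_le_of_notMem_greedyTree p n hmem hv)
    linarith
  have h := ht.trans (Set.encard_le_encard hsub)
  rw [Set.encard_coe_eq_coe_finsetCard, card_erase_of_mem hv, card_greedyTree] at h
  have := Nat.cast_le.1 h
  omega

theorem isGreatest_kthValue (p : TokenTree V) (n : ℕ) :
    IsGreatest ((fun v => -Real.log (nodeProb p v)) '' (greedyTree p n : Set (List V)))
      (kthValue (n + 1) p) := by
  obtain ⟨m, hm, hmax⟩ := Finset.exists_max_image (greedyTree p n)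
    (fun v => -Real.log (nodeProb p v)) ⟨[], (isDraftTree_greedyTree p n).root_mem⟩
  have h : kthValue (n + 1) p = -Real.log (nodeProb p m) := by
    refine le_antisymm (csInf_le (bddBelow_setOf_le_nodeCount p n)
      (le_nodeCount_of_forall_greedyTree hmax)) ?_
    exact le_csInf ⟨_, le_nodeCount_of_forall_greedyTree hmax⟩ fun t ht => le_of_le_nodeCount ht hm
  rw [h]
  exact ⟨⟨m, hm, rfl⟩, by rintro _ ⟨v, hv, rfl⟩; exact hmax v hv⟩

theorem neg_log_nodeProb_le_kthValue (p : TokenTree V) (n : ℕ) {v : List V}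
    (hv : v ∈ greedyTree p n) : -Real.log (nodeProb p v) ≤ kthValue (n + 1) p :=
  (isGreatest_kthValue p n).2 ⟨v, hv, rfl⟩

theorem kthValue_nonneg (p : TokenTree V) (n : ℕ) : 0 ≤ kthValue (n + 1) p := by
  have := neg_log_nodeProb_le_kthValue p n (isDraftTree_greedyTree p n).root_mem
  simpa [nodeProb] using this

/-- Average over the exit distribution: boundary nodes are no more probable than the last greedy
node, so their values are at least `kthValue`. -/
theorem kthValue_le_sum (p : TokenTree V) (n : ℕ) :
    kthValue (n + 1) p ≤ ∑ v ∈ greedyTree p n, nodeProb p v * simplexEntropy (p v) := by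
  have hT := isDraftTree_greedyTree p n
  rw [← sum_treeBoundary_negMulLog hT, ← mul_one (kthValue (n + 1) p),
    ← sum_treeBoundary_nodeProb hT p, Finset.mul_sum]
  refine Finset.sum_le_sum fun u hu => ?_
  -- Null nodes are separated because `Real.log 0 = 0` would give them value 0; their weight is 0
  -- anyway.
  rcases (nodeProb_nonneg p u).eq_or_lt with h | h
  · simp [← h]
  · rw [Real.negMulLog, mul_comm, neg_mul, ← mul_neg]
    refine mul_le_mul_of_nonneg_left ?_ h.le
    obtain ⟨m, hm, hmk⟩ := (isGreatest_kthValue p n).1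
    rw [← hmk]
    exact neg_le_neg (Real.log_le_log h (nodeProb_le_of_mem_treeBoundary_greedyTree p n hu hm))

end TokenTree

section RandomTree

open Finset MeasureTheory

variable {V : Type*} [Fintype V]

/-! ### Measurability -/

theorem measurable_simplex_apply (x : V) : Measurable fun b : stdSimplex ℝ V => b.1 x :=
  (measurable_pi_apply x).comp measurable_subtype_coe

theorem measurable_nodeProb (v : List V) : Measurable fun p : TokenTree V => nodeProb p v := by
  induction v using List.reverseRecOn with
  | nil => simp [nodeProb]
  | append_singleton v x ih =>
    simp_rw [nodeProb_append_singleton]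
    exact ih.mul ((measurable_simplex_apply x).comp (measurable_pi_apply v))

theorem measurable_simplexEntropy : Measurable (simplexEntropy : stdSimplex ℝ V → ℝ) :=
  Finset.measurable_sum _ fun x _ =>
    Real.continuous_negMulLog.measurable.comp (measurable_simplex_apply x)

theorem simplexEntropy_nonneg (b : stdSimplex ℝ V) : 0 ≤ simplexEntropy b :=
  Finset.sum_nonneg fun x _ => Real.negMulLog_nonneg (b.2.1 x) (stdSimplex_apply_le_one b x)

theorem simplexEntropy_le_card (b : stdSimplex ℝ V) : simplexEntropy b ≤ Fintype.card V := by
  have h : ∀ x ∈ (univ : Finset V), Real.negMulLog (b.1 x) ≤ 1 := fun x _ => by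
    have := Real.negMulLog_le_one_sub_self (b.2.1 x)
    linarith [b.2.1 x]
  simpa [simplexEntropy] using Finset.sum_le_card_nsmul _ _ _ h

variable [DecidableEq V]

theorem measurableSet_boundaryMaximizers (S M : Finset (List V)) :
    MeasurableSet {p : TokenTree V | boundaryMaximizers p S = M} := by
  have h : {p : TokenTree V | boundaryMaximizers p S = M} =
      ⋂ v, {p | (v ∈ treeBoundary S ∧ ∀ u ∈ treeBoundary S, nodeProb p u ≤ nodeProb p v) ↔
        v ∈ M} := by
    ext p
    simp [Finset.ext_iff, boundaryMaximizers]
  rw [h]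
  refine MeasurableSet.iInter fun v => ?_
  have hv : MeasurableSet {p : TokenTree V |
      v ∈ treeBoundary S ∧ ∀ u ∈ treeBoundary S, nodeProb p u ≤ nodeProb p v} := by
    refine (MeasurableSet.const _).inter ?_
    have : {p : TokenTree V | ∀ u ∈ treeBoundary S, nodeProb p u ≤ nodeProb p v} =
        ⋂ u ∈ treeBoundary S, {p | nodeProb p u ≤ nodeProb p v} := by
      ext; simp
    refine (congrArg MeasurableSet this).mpr ?_
    exact Finset.measurableSet_biInter _ fun u _ => measurableSet_le
      (measurable_nodeProb u) (measurable_nodeProb v)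
  by_cases hM : v ∈ M
  · simpa only [hM, iff_true] using hv
  · simp only [hM, iff_false]
    exact hv.compl

theorem measurableSet_greedyTree_eq (n : ℕ) (S : Finset (List V)) :
    MeasurableSet {p : TokenTree V | greedyTree p n = S} := by
  induction n generalizing S with
  | zero => exact MeasurableSet.const ({[]} = S)
  | succ n ih =>
    have h : {p : TokenTree V | greedyTree p (n + 1) = S} =
        -- Only countably many `T` and `M` occur, and once they are fixed the insertion condition is
        -- constant: the choice function needs no measurability.
        ⋃ (T : Finset (List V)) (M : Finset (List V)),
          {p | greedyTree p n = T} ∩ {p | boundaryMaximizers p T = M} ∩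
            {_p | insert (pickNode M) T = S} := by
      ext p
      simp [greedyTree]
    rw [h]
    exact MeasurableSet.iUnion fun T => MeasurableSet.iUnion fun M =>
      ((ih T).inter (measurableSet_boundaryMaximizers T M)).inter (MeasurableSet.const _)

theorem measurableSet_mem_greedyTree (n : ℕ) (v : List V) :
    MeasurableSet {p : TokenTree V | v ∈ greedyTree p n} := by
  have h : {p : TokenTree V | v ∈ greedyTree p n} =
      ⋃ S ∈ {S : Finset (List V) | v ∈ S}, {p | greedyTree p n = S} := by
    ext p
    simp
  rw [h]
  exact MeasurableSet.biUnion (Set.to_countable _) fun S _ => measurableSet_greedyTree_eq n S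

theorem measurable_kthValue (n : ℕ) : Measurable (kthValue (n + 1) : TokenTree V → ℝ) := by
  refine measurable_of_Iic fun t => ?_
  have h : kthValue (n + 1) ⁻¹' Set.Iic t = ⋂ v : List V,
      ({p : TokenTree V | v ∈ greedyTree p n}ᶜ ∪ {p | -Real.log (nodeProb p v) ≤ t}) := by
    ext p
    simp only [Set.mem_preimage, Set.mem_Iic, isLUB_le_iff (isGreatest_kthValue p n).isLUB,
      mem_upperBounds, Set.forall_mem_image, mem_coe, Set.mem_iInter, Set.mem_union,
      Set.mem_compl_iff, Set.mem_ofPred_eq, ← imp_iff_not_or]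
  rw [h]
  exact MeasurableSet.iInter fun v => (measurableSet_mem_greedyTree n v).compl.union
    (measurableSet_le (measurable_nodeProb v).log.neg measurable_const)

/-- The probability of `v` if `v` belongs to the greedy tree, and `0` otherwise. -/
noncomputable def greedyProb (n : ℕ) (v : List V) (p : TokenTree V) : ℝ :=
  if v ∈ greedyTree p n then nodeProb p v else 0

theorem measurable_greedyProb (n : ℕ) (v : List V) : Measurable (greedyProb n v) :=
  Measurable.ite (measurableSet_mem_greedyTree n v) (measurable_nodeProb v) measurable_const

theorem greedyProb_update (n : ℕ) (v : List V) (p : TokenTree V) (b : stdSimplex ℝ V) :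
    greedyProb n v (Function.update p v b) = greedyProb n v p := by
  simp only [greedyProb, mem_greedyTree_update, nodeProb_update]

theorem greedyProb_nonneg (n : ℕ) (v : List V) (p : TokenTree V) : 0 ≤ greedyProb n v p := by
  unfold greedyProb
  split_ifs
  exacts [nodeProb_nonneg p v, le_rfl]

theorem greedyProb_le_one (n : ℕ) (v : List V) (p : TokenTree V) : greedyProb n v p ≤ 1 := by
  unfold greedyProb
  split_ifs
  exacts [nodeProb_le_one p v, zero_le_one]

/-- The nodes whose length belongs to `A`. -/
def treeLevels (V : Type*) [Fintype V] [DecidableEq V] (A : Finset ℕ) : Finset (List V) :=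
  A.biUnion (treeLevel V)

theorem mem_treeLevels {A : Finset ℕ} {v : List V} : v ∈ treeLevels V A ↔ v.length ∈ A := by
  simp [treeLevels, mem_treeLevel]

theorem sum_treeLevels (A : Finset ℕ) (f : List V → ℝ) :
    ∑ v ∈ treeLevels V A, f v = ∑ k ∈ A, ∑ v ∈ treeLevel V k, f v := by
  refine Finset.sum_biUnion fun i _ j _ hij => Finset.disjoint_left.2 fun v hi hj => hij ?_
  rw [← mem_treeLevel.1 hi, ← mem_treeLevel.1 hj]

theorem greedyTree_subset_treeLevels (p : TokenTree V) (n : ℕ) :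
    greedyTree p n ⊆ treeLevels V (range (n + 1)) := fun _ hv =>
  mem_treeLevels.2 (mem_range.2 (Nat.lt_succ_of_le (length_le_of_mem_greedyTree p n hv)))

theorem sum_greedyProb_mul (p : TokenTree V) (n : ℕ) (f : List V → ℝ) :
    ∑ v ∈ treeLevels V (range (n + 1)), greedyProb n v p * f v =
      ∑ v ∈ greedyTree p n, nodeProb p v * f v := by
  rw [← Finset.sum_subset (greedyTree_subset_treeLevels p n)]
  · exact Finset.sum_congr rfl fun v hv => by rw [greedyProb, if_pos hv]
  · intro v _ hv
    rw [greedyProb, if_neg hv, zero_mul]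

/-! ### Independence -/

variable {Ω : Type*} [MeasurableSpace Ω] {ℙ : Measure Ω} [IsProbabilityMeasure ℙ]
  {β : List V → Ω → stdSimplex ℝ V}

omit [IsProbabilityMeasure ℙ] in
theorem integrable_of_measurable_of_le {f : Ω → ℝ} (hf : Measurable f) (C : ℝ)
    [IsFiniteMeasure ℙ] (h0 : ∀ ω, 0 ≤ f ω) (hC : ∀ ω, f ω ≤ C) : Integrable f ℙ :=
  Integrable.of_bound hf.aestronglyMeasurable C
    (Filter.Eventually.of_forall fun ω => by rw [Real.norm_of_nonneg (h0 ω)]; exact hC ω)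

omit [DecidableEq V] [IsProbabilityMeasure ℙ] in
theorem IsIIDTokenTree.measurable_tree (hβ : IsIIDTokenTree ℙ β) :
    Measurable fun ω => (fun v => β v ω : TokenTree V) :=
  measurable_pi_iff.2 hβ.measurable

/-- The distribution at `v` is independent of the quantities that do not involve it. -/
theorem IsIIDTokenTree.integral_mul_eq (hβ : IsIIDTokenTree ℙ β) (v : List V)
    {g : TokenTree V → ℝ} (hg : Measurable g)
    (hgv : ∀ p b, g (Function.update p v b) = g p) {h : stdSimplex ℝ V → ℝ} (hh : Measurable h) :
    ∫ ω, g (fun u => β u ω) * h (β v ω) ∂ℙ =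
      (∫ ω, g (fun u => β u ω) ∂ℙ) * ∫ ω, h (β [] ω) ∂ℙ := by
  obtain ⟨ω₀⟩ := nonempty_of_isProbabilityMeasure ℙ
  -- Freezing the coordinate at `v` leaves a function of the other coordinates; by `hgv`, `g` does
  -- not notice.
  have hindep : ProbabilityTheory.IndepFun (fun ω => Function.update (fun u => β u ω) v (β [] ω₀)) (β v) ℙ := by
    rw [ProbabilityTheory.IndepFun_iff_Indep]
    have h1 := ProbabilityTheory.indep_iSup_of_disjoint (fun u => (hβ.measurable u).comap_le) hβ.indep.iIndep
      (S := {v}ᶜ) (T := {v}) disjoint_compl_left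
    rw [_root_.iSup_singleton] at h1
    refine ProbabilityTheory.indep_of_indep_of_le_left h1 ?_
    rw [← measurable_iff_comap_le]
    refine @measurable_pi_lambda _ _ _ (_) _ _ fun u => ?_
    by_cases huv : u = v
    · subst huv
      simp
    · simp only [Function.update_of_ne huv]
      exact (comap_measurable (β u)).mono (le_iSup₂_of_le u huv le_rfl) le_rfl
  have h2 := (hindep.comp hg hh).integral_fun_mul_eq_mul_integral
    ((hg.comp (measurable_update_left.comp hβ.measurable_tree)).aestronglyMeasurable)
    ((hh.comp (hβ.measurable v)).aestronglyMeasurable)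
  simp only [Function.comp_apply, hgv] at h2
  have h3 : ∫ ω, h (β v ω) ∂ℙ = ∫ ω, h (β [] ω) ∂ℙ :=
    ((hβ.identDistrib v).comp hh).integral_eq
  rw [h2, h3]

/-! ### Wald's identity and positivity of the entropy -/

theorem IsIIDTokenTree.expectedTokens_eq (hβ : IsIIDTokenTree ℙ β) {n : ℕ}
    {D : TokenTree V → Finset (List V)} (hD : IsOptimalDrafter (n + 1) D) :
    expectedTokens ℙ β D =
      ∑ v ∈ treeLevels V (range (n + 1)), ∫ ω, greedyProb n v (fun u => β u ω) ∂ℙ := by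
  rw [← integral_finsetSum]
  -- The integrands agree for every outcome, so `D` need not be measurable.
  · refine integral_congr_ae (Filter.Eventually.of_forall fun ω => ?_)
    simpa using (expectedAccepted_optimal hD _).trans
      (by simpa using (sum_greedyProb_mul (fun u => β u ω) n fun _ => 1).symm)
  · exact fun v _ => integrable_of_measurable_of_le
      ((measurable_greedyProb n v).comp hβ.measurable_tree) 1
      (fun _ => greedyProb_nonneg _ _ _) fun _ => greedyProb_le_one _ _ _

omit [IsProbabilityMeasure ℙ] [DecidableEq V] in
theorem expectedEntropy_eq : expectedEntropy ℙ β = ∫ ω, simplexEntropy (β [] ω) ∂ℙ := by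
  simp [expectedEntropy, simplexEntropy, Real.negMulLog]

theorem IsIIDTokenTree.integrable_kthValue (hβ : IsIIDTokenTree ℙ β) (n : ℕ) :
    Integrable (fun ω => kthValue (n + 1) fun v => β v ω) ℙ := by
  refine integrable_of_measurable_of_le ((measurable_kthValue n).comp hβ.measurable_tree)
    (((n + 1 : ℕ) : ℝ) * Fintype.card V) (fun ω => kthValue_nonneg _ _) fun ω => ?_
  refine (kthValue_le_sum _ n).trans ?_
  rw [← card_greedyTree (fun v => β v ω) n, ← nsmul_eq_mul]
  refine Finset.sum_le_card_nsmul _ _ _ fun v _ => ?_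
  exact (mul_le_of_le_one_left (simplexEntropy_nonneg _) (nodeProb_le_one _ _)).trans
    (simplexEntropy_le_card _)

theorem IsIIDTokenTree.integral_kthValue_le (hβ : IsIIDTokenTree ℙ β) {n : ℕ}
    {D : TokenTree V → Finset (List V)} (hD : IsOptimalDrafter (n + 1) D) :
    ∫ ω, kthValue (n + 1) (fun v => β v ω) ∂ℙ ≤
      expectedTokens ℙ β D * expectedEntropy ℙ β := by
  rw [hβ.expectedTokens_eq hD, expectedEntropy_eq, Finset.sum_mul]
  have hint (v : List V) : Integrable
      (fun ω => greedyProb n v (fun u => β u ω) * simplexEntropy (β v ω)) ℙ := by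
    refine integrable_of_measurable_of_le (((measurable_greedyProb n v).comp
      hβ.measurable_tree).mul (measurable_simplexEntropy.comp (hβ.measurable v)))
      (Fintype.card V) (fun ω => mul_nonneg (greedyProb_nonneg _ _ _) (simplexEntropy_nonneg _))
      fun ω => ?_
    exact (mul_le_of_le_one_left (simplexEntropy_nonneg _) (greedyProb_le_one _ _ _)).trans
      (simplexEntropy_le_card _)
  simp_rw [← fun v => hβ.integral_mul_eq v (measurable_greedyProb n v) (greedyProb_update n v)
    measurable_simplexEntropy]
  rw [← integral_finsetSum _ fun v _ => hint v]
  refine integral_mono (hβ.integrable_kthValue n) (integrable_finsetSum _ fun v _ => hint v)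
    fun ω => ?_
  have := sum_greedyProb_mul (fun u => β u ω) n fun v => simplexEntropy (β v ω)
  simp only [this]
  exact kthValue_le_sum _ n

omit [DecidableEq V] in
theorem IsIIDTokenTree.expectedEntropy_pos (hβ : IsIIDTokenTree ℙ β) :
    0 < expectedEntropy ℙ β := by
  rw [expectedEntropy_eq]
  refine (integral_nonneg fun ω => simplexEntropy_nonneg _).lt_of_ne fun h => ?_
  have hint : Integrable (fun ω => simplexEntropy (β [] ω)) ℙ :=
    integrable_of_measurable_of_le (measurable_simplexEntropy.comp (hβ.measurable []))
      (Fintype.card V) (fun _ => simplexEntropy_nonneg _) fun _ => simplexEntropy_le_card _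
  have hae := (integral_eq_zero_iff_of_nonneg (fun ω => simplexEntropy_nonneg _) hint).1 h.symm
  refine hβ.not_pointMass.ne ((measure_congr (Filter.eventuallyEq_univ.2 ?_)).trans measure_univ)
  filter_upwards [hae] with ω hω
  have hx := (Finset.sum_eq_zero_iff_of_nonneg fun x _ =>
    Real.negMulLog_nonneg ((β [] ω).2.1 x) (stdSimplex_apply_le_one _ x)).1 hω
  by_contra! hne
  have h0 (x : V) : (β [] ω).1 x = 0 := by
    have h1 := hx x (mem_univ x)
    have h2 := (β [] ω).2.1 x
    rw [Real.negMulLog, neg_mul, neg_eq_zero, mul_eq_zero, Real.log_eq_zero] at h1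
    rcases h1 with h | h | h | h
    · exact h
    · exact h
    · exact absurd h (hne x)
    · linarith
  have := (β [] ω).2.2
  simp [h0] at this

/-! ### Moments of the acceptance probabilities -/

/-- The expected value of `∑ x, β(x) ^ s`. -/
noncomputable def powerMoment (ℙ : Measure Ω) (β : List V → Ω → stdSimplex ℝ V) (s : ℝ) : ℝ :=
  ∑ x, ∫ ω, (β [] ω).1 x ^ s ∂ℙ

omit [DecidableEq V] [IsProbabilityMeasure ℙ] in
theorem powerMoment_nonneg (s : ℝ) : 0 ≤ powerMoment ℙ β s :=
  Finset.sum_nonneg fun x _ => integral_nonneg fun ω => Real.rpow_nonneg ((β [] ω).2.1 x) s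

omit [DecidableEq V] in
theorem IsIIDTokenTree.integrable_nodeProb_rpow (hβ : IsIIDTokenTree ℙ β) {s : ℝ} (hs : 0 ≤ s)
    (v : List V) : Integrable (fun ω => nodeProb (fun u => β u ω) v ^ s) ℙ :=
  integrable_of_measurable_of_le
    (((measurable_nodeProb v).comp hβ.measurable_tree).pow_const s) 1
    (fun _ => Real.rpow_nonneg (nodeProb_nonneg _ _) s)
    fun _ => Real.rpow_le_one (nodeProb_nonneg _ _) (nodeProb_le_one _ _) hs

/-- Branching recursion: $P(v)$ is independent of the distribution at $v$, so each level contributes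
one factor. -/
theorem IsIIDTokenTree.sum_integral_nodeProb_rpow (hβ : IsIIDTokenTree ℙ β) (s : ℝ) (k : ℕ) :
    ∑ v ∈ treeLevel V k, ∫ ω, nodeProb (fun u => β u ω) v ^ s ∂ℙ = powerMoment ℙ β s ^ k := by
  induction k with
  | zero => simp [treeLevel, nodeProb]
  | succ k ih =>
    rw [treeLevel, sum_childNodes, pow_succ, ← ih, Finset.sum_mul]
    refine Finset.sum_congr rfl fun v _ => ?_
    rw [powerMoment, Finset.mul_sum]
    refine Finset.sum_congr rfl fun x _ => ?_
    rw [← hβ.integral_mul_eq v (g := fun p => nodeProb p v ^ s)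
      ((measurable_nodeProb v).pow_const s) (fun p b => by rw [nodeProb_update])
      (h := fun b => b.1 x ^ s) ((measurable_simplex_apply x).pow_const s)]
    refine integral_congr_ae (Filter.Eventually.of_forall fun ω => ?_)
    simp only [nodeProb_append_singleton]
    exact Real.mul_rpow (nodeProb_nonneg _ _) ((β v ω).2.1 x)

theorem rpow_one_add_le {x θ : ℝ} (hx : 0 ≤ x) (hx1 : x ≤ 1) (hθ : 0 ≤ θ) :
    x ^ (1 + θ) ≤ x - θ * Real.negMulLog x + 2 * θ ^ 2 := by
  rcases hx.eq_or_lt with rfl | hpos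
  · rw [Real.zero_rpow (by linarith)]
    simp [sq_nonneg]
  · set y := -Real.log x with hy
    have hy0 : 0 ≤ y := neg_nonneg.2 (Real.log_nonpos hx hx1)
    have hxy : x = Real.exp (-y) := by rw [hy, neg_neg, Real.exp_log hpos]
    -- From $e^y\ge 1+y+y^2/2$; this makes the quadratic error uniform in `x`.
    have hsq : x * y ^ 2 ≤ 2 := by
      have h1 := Real.quadratic_le_exp_of_nonneg hy0
      have h2 : x * Real.exp y = 1 := by rw [hxy, ← Real.exp_add]; simp
      nlinarith
    -- With $z=\theta y$: $e^{-z}\le 1/(1+z)\le 1-z+z^2$, as $(1+z)(1-z+z^2)=1+z^3$.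
    have hexp : Real.exp (-(θ * y)) ≤ 1 - θ * y + (θ * y) ^ 2 := by
      have h0 : 0 ≤ θ * y := mul_nonneg hθ hy0
      have h1 := Real.add_one_le_exp (θ * y)
      rw [Real.exp_neg]
      refine (inv_anti₀ (by linarith) h1).trans ?_
      rw [inv_le_iff_one_le_mul₀ (by linarith)]
      nlinarith [pow_nonneg h0 3]
    have hlog : Real.negMulLog x = x * y := by rw [Real.negMulLog, hy]; ring
    rw [Real.rpow_add hpos, Real.rpow_one, Real.rpow_def_of_pos hpos, hlog,
      show Real.log x * θ = -(θ * y) by rw [hy]; ring]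
    nlinarith [mul_le_mul_of_nonneg_left hexp hx, mul_le_mul_of_nonneg_right hsq (sq_nonneg θ)]

omit [DecidableEq V] in
theorem IsIIDTokenTree.powerMoment_le (hβ : IsIIDTokenTree ℙ β) {θ : ℝ} (hθ : 0 ≤ θ) :
    powerMoment ℙ β (1 + θ) ≤
      1 - θ * expectedEntropy ℙ β + 2 * Fintype.card V * θ ^ 2 := by
  have hint (x : V) : Integrable (fun ω => (β [] ω).1 x ^ (1 + θ)) ℙ :=
    integrable_of_measurable_of_le
      (((measurable_simplex_apply x).comp (hβ.measurable [])).pow_const _) 1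
      (fun ω => Real.rpow_nonneg ((β [] ω).2.1 x) _)
      fun ω => Real.rpow_le_one ((β [] ω).2.1 x) (stdSimplex_apply_le_one _ x) (by linarith)
  have hintH : Integrable (fun ω => simplexEntropy (β [] ω)) ℙ :=
    integrable_of_measurable_of_le (measurable_simplexEntropy.comp (hβ.measurable []))
      (Fintype.card V) (fun _ => simplexEntropy_nonneg _) fun _ => simplexEntropy_le_card _
  have hrhs : 1 - θ * expectedEntropy ℙ β + 2 * Fintype.card V * θ ^ 2 =
      ∫ ω, (1 - θ * simplexEntropy (β [] ω) + 2 * Fintype.card V * θ ^ 2) ∂ℙ := by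
    have h1 : Integrable (fun ω => 1 - θ * simplexEntropy (β [] ω)) ℙ :=
      (integrable_const _).sub (hintH.const_mul θ)
    rw [integral_add h1 (integrable_const _),
      integral_sub (integrable_const _) (hintH.const_mul θ), integral_const_mul,
      expectedEntropy_eq]
    simp
  rw [powerMoment, ← integral_finsetSum _ fun x _ => hint x, hrhs]
  refine integral_mono (integrable_finsetSum _ fun x _ => hint x)
    (((integrable_const _).sub (hintH.const_mul θ)).add (integrable_const _)) fun ω => ?_
  refine (Finset.sum_le_sum fun x _ => rpow_one_add_le ((β [] ω).2.1 x)
    (stdSimplex_apply_le_one _ x) hθ).trans_eq ?_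
  rw [Finset.sum_add_distrib, Finset.sum_sub_distrib, ← Finset.mul_sum, (β [] ω).2.2,
    simplexEntropy]
  simp
  ring

end RandomTree

/-! ### Moment bounds and asymptotics -/

section Bounds

open Finset MeasureTheory

variable {V : Type*} [Fintype V] [DecidableEq V]

theorem sum_treeLevel_nodeProb (p : TokenTree V) (k : ℕ) :
    ∑ v ∈ treeLevel V k, nodeProb p v = 1 := by
  induction k with
  | zero => simp [treeLevel, nodeProb]
  | succ k ih =>
    rw [treeLevel, sum_childNodes]
    simpa only [sum_nodeProb_append] using ih

/-- Each of the `n + 1` greedy nodes satisfies $t-T\le y:=t+\log P(v)\le e^{(1+\theta)y}$. Being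
linear in $T$, the bound passes directly to $E[T]$. -/
theorem mul_sub_kthValue_le (p : TokenTree V) (n : ℕ) {θ : ℝ} (hθ : 0 ≤ θ) (t : ℝ) :
    ((n + 1 : ℕ) : ℝ) * (t - kthValue (n + 1) p) ≤
      Real.exp ((1 + θ) * t) * ∑ v ∈ treeLevels V (range (n + 1)), nodeProb p v ^ (1 + θ) := by
  have h1 := Finset.card_nsmul_le_sum (greedyTree p n) (fun v => t + Real.log (nodeProb p v))
    (t - kthValue (n + 1) p) fun v hv => ?_
  · rw [card_greedyTree, nsmul_eq_mul] at h1
    refine h1.trans ?_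
    rw [Finset.mul_sum]
    refine le_trans (Finset.sum_le_sum fun v hv => ?_) (Finset.sum_le_sum_of_subset_of_nonneg
      (greedyTree_subset_treeLevels p n) fun v _ _ =>
        mul_nonneg (Real.exp_pos _).le (Real.rpow_nonneg (nodeProb_nonneg p v) _))
    rw [Real.rpow_def_of_pos (nodeProb_pos_of_mem_greedyTree p n hv), ← Real.exp_add]
    set y := t + Real.log (nodeProb p v) with hy
    have h : (1 + θ) * t + Real.log (nodeProb p v) * (1 + θ) = (1 + θ) * y := by rw [hy]; ring
    rw [h]
    rcases le_total y 0 with h0 | h0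
    · exact h0.trans (Real.exp_pos _).le
    · nlinarith [Real.add_one_le_exp ((1 + θ) * y), mul_nonneg hθ h0]
  · have := neg_log_nodeProb_le_kthValue p n hv
    linarith

theorem sum_greedyTree_le (p : TokenTree V) (n K : ℕ) {θ : ℝ} (hθ : 0 ≤ θ) :
    ∑ v ∈ greedyTree p n, nodeProb p v ≤ K + 1 + ((n + 1 : ℕ) : ℝ) ^ θ *
      ∑ v ∈ treeLevels V (Ico K (K + (n + 1))), nodeProb p v ^ (1 + θ) := by
  have hn : (0 : ℝ) < (n + 1 : ℕ) := by positivity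
  -- With $Q=n+1$: if $x\ge 1/Q$ then $(Qx)^\theta\ge 1$. The terms $1/Q$ add up to at most 1 over
  -- the tree.
  have hle (x : ℝ) (hx : 0 ≤ x) :
      x ≤ ((n + 1 : ℕ) : ℝ)⁻¹ + ((n + 1 : ℕ) : ℝ) ^ θ * x ^ (1 + θ) := by
    rcases le_total x ((n + 1 : ℕ) : ℝ)⁻¹ with h | h
    · have := mul_nonneg (Real.rpow_nonneg hn.le θ) (Real.rpow_nonneg hx (1 + θ))
      linarith
    · have hx0 : 0 < x := (inv_pos.2 hn).trans_le h
      have h1 : 1 ≤ (((n + 1 : ℕ) : ℝ) * x) ^ θ :=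
        Real.one_le_rpow ((inv_le_iff_one_le_mul₀' hn).1 h) hθ
      rw [Real.mul_rpow hn.le hx] at h1
      rw [Real.rpow_add hx0, Real.rpow_one]
      have := mul_le_mul_of_nonneg_left h1 hx
      have h2 := inv_pos.2 hn
      linarith
  rw [← Finset.sum_filter_add_sum_filter_not (greedyTree p n) (fun v => v.length < K)]
  have h1 : ∑ v ∈ greedyTree p n with v.length < K, nodeProb p v ≤ K := by
    calc _ ≤ ∑ v ∈ treeLevels V (range K), nodeProb p v :=
          Finset.sum_le_sum_of_subset_of_nonneg
            (fun v hv => mem_treeLevels.2 (mem_range.2 (mem_filter.1 hv).2))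
            fun v _ _ => nodeProb_nonneg p v
      _ = K := by simp [sum_treeLevels, sum_treeLevel_nodeProb]
  have h2 : ∑ v ∈ greedyTree p n with ¬ v.length < K, nodeProb p v ≤
      1 + ((n + 1 : ℕ) : ℝ) ^ θ *
        ∑ v ∈ treeLevels V (Ico K (K + (n + 1))), nodeProb p v ^ (1 + θ) := by
    refine (Finset.sum_le_sum fun v _ => hle _ (nodeProb_nonneg p v)).trans ?_
    rw [Finset.sum_add_distrib, ← Finset.mul_sum]
    refine add_le_add ?_ (mul_le_mul_of_nonneg_left (Finset.sum_le_sum_of_subset_of_nonneg ?_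
      fun v _ _ => Real.rpow_nonneg (nodeProb_nonneg p v) _) (Real.rpow_nonneg hn.le θ))
    · rw [Finset.sum_const, nsmul_eq_mul, ← div_eq_mul_inv, div_le_one hn, Nat.cast_le]
      exact (Finset.card_filter_le _ _).trans (card_greedyTree p n).le
    · intro v hv
      obtain ⟨hv, hK⟩ := mem_filter.1 hv
      have := length_le_of_mem_greedyTree p n hv
      exact mem_treeLevels.2 (mem_Ico.2 ⟨by omega, by omega⟩)
  linarith

variable {Ω : Type*} [MeasurableSpace Ω] {ℙ : Measure Ω} [IsProbabilityMeasure ℙ]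
  {β : List V → Ω → stdSimplex ℝ V}

theorem IsIIDTokenTree.integral_sum_treeLevels (hβ : IsIIDTokenTree ℙ β) {s : ℝ} (hs : 0 ≤ s)
    (A : Finset ℕ) : ∫ ω, ∑ v ∈ treeLevels V A, nodeProb (fun u => β u ω) v ^ s ∂ℙ =
      ∑ k ∈ A, powerMoment ℙ β s ^ k := by
  rw [integral_finsetSum _ fun v _ => hβ.integrable_nodeProb_rpow hs v, sum_treeLevels]
  exact Finset.sum_congr rfl fun k _ => hβ.sum_integral_nodeProb_rpow s k

theorem geom_sum_le_inv {m : ℝ} (hm0 : 0 ≤ m) (hm : m < 1) (n : ℕ) :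
    ∑ k ∈ range n, m ^ k ≤ (1 - m)⁻¹ := by
  rw [← tsum_geometric_of_lt_one hm0 hm]
  exact (summable_geometric_of_lt_one hm0 hm).sum_le_tsum _ fun k _ => pow_nonneg hm0 k

theorem IsIIDTokenTree.mul_sub_integral_kthValue_le (hβ : IsIIDTokenTree ℙ β) (n : ℕ) {θ : ℝ}
    (hθ : 0 ≤ θ) (hm : powerMoment ℙ β (1 + θ) < 1) (t : ℝ) :
    ((n + 1 : ℕ) : ℝ) * (t - ∫ ω, kthValue (n + 1) (fun v => β v ω) ∂ℙ) ≤
      Real.exp ((1 + θ) * t) * (1 - powerMoment ℙ β (1 + θ))⁻¹ := by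
  have hs : 0 ≤ 1 + θ := by linarith
  calc _ = ∫ ω, ((n + 1 : ℕ) : ℝ) * (t - kthValue (n + 1) (fun v => β v ω)) ∂ℙ := by
        rw [integral_const_mul, integral_sub (integrable_const _) (hβ.integrable_kthValue n)]
        simp
    _ ≤ ∫ ω, Real.exp ((1 + θ) * t) *
          ∑ v ∈ treeLevels V (range (n + 1)), nodeProb (fun u => β u ω) v ^ (1 + θ) ∂ℙ :=
        integral_mono (((integrable_const _).sub (hβ.integrable_kthValue n)).const_mul _)
          ((integrable_finsetSum _ fun v _ => hβ.integrable_nodeProb_rpow hs v).const_mul _)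
          fun ω => mul_sub_kthValue_le _ n hθ t
    _ ≤ _ := by
        rw [integral_const_mul, hβ.integral_sum_treeLevels hs]
        exact mul_le_mul_of_nonneg_left (geom_sum_le_inv (powerMoment_nonneg _) hm _)
          (Real.exp_pos _).le

theorem IsIIDTokenTree.expectedTokens_le (hβ : IsIIDTokenTree ℙ β) {n : ℕ}
    {D : TokenTree V → Finset (List V)} (hD : IsOptimalDrafter (n + 1) D) (K : ℕ) {θ : ℝ}
    (hθ : 0 ≤ θ) (hm : powerMoment ℙ β (1 + θ) < 1) :
    expectedTokens ℙ β D ≤ K + 1 + ((n + 1 : ℕ) : ℝ) ^ θ *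
      (powerMoment ℙ β (1 + θ) ^ K * (1 - powerMoment ℙ β (1 + θ))⁻¹) := by
  have hs : 0 ≤ 1 + θ := by linarith
  have hint := (integrable_finsetSum (treeLevels V (Ico K (K + (n + 1)))) fun v _ =>
    hβ.integrable_nodeProb_rpow hs v).const_mul (((n + 1 : ℕ) : ℝ) ^ θ)
  calc _ ≤ ∫ ω, ((K + 1 : ℝ) + ((n + 1 : ℕ) : ℝ) ^ θ * ∑ v ∈ treeLevels V (Ico K (K + (n + 1))),
          nodeProb (fun u => β u ω) v ^ (1 + θ)) ∂ℙ := by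
        refine integral_mono_of_nonneg (Filter.Eventually.of_forall fun ω => ?_)
          ((integrable_const _).add hint) (Filter.Eventually.of_forall fun ω => ?_)
        · simp only [expectedAccepted_optimal hD]
          exact Finset.sum_nonneg fun v _ => nodeProb_nonneg _ v
        · simp only [expectedAccepted_optimal hD]
          exact sum_greedyTree_le _ n K hθ
    _ ≤ _ := by
        rw [integral_add (integrable_const _) hint, integral_const_mul,
          hβ.integral_sum_treeLevels hs, Finset.sum_Ico_eq_sum_range]
        simp only [integral_const, probReal_univ, one_smul, pow_add, ← Finset.mul_sum,
          add_tsub_cancel_left]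
        gcongr
        · exact pow_nonneg (powerMoment_nonneg _) K
        · exact geom_sum_le_inv (powerMoment_nonneg _) hm _

theorem IsIIDTokenTree.exists_log_sub_le (hβ : IsIIDTokenTree ℙ β) :
    ∃ C : ℝ, ∀ P : ℕ, 2 ≤ P →
      Real.log P - Real.log (Real.log P) - C ≤ ∫ ω, kthValue P (fun v => β v ω) ∂ℙ := by
  set μ := expectedEntropy ℙ β with hμ
  have hμ0 : 0 < μ := hβ.expectedEntropy_pos
  set N : ℝ := (Fintype.card V : ℝ) with hN
  have hN0 : 0 ≤ N := Nat.cast_nonneg _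
  -- For $\theta\le\delta$ the error $2N\theta^2$ is at most $\theta\mu/2$, so
  -- $1-m(1+\theta)\ge\theta\mu/2$.
  set δ := min 1 (μ / (4 * (N + 1))) with hδ
  have hδ0 : 0 < δ := lt_min one_pos (by positivity)
  have hδ1 : δ ≤ 1 := min_le_left _ _
  have hδμ : 4 * N * δ ≤ μ := by
    have h := (le_div_iff₀ (by positivity)).1 (min_le_right 1 (μ / (4 * (N + 1))))
    rw [← hδ] at h
    nlinarith
  refine ⟨8 * Real.exp 1 / (δ * μ), fun P hP => ?_⟩
  obtain ⟨n, rfl⟩ : ∃ n, P = n + 1 := ⟨P - 1, by omega⟩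
  have hP2 : (2 : ℝ) ≤ (n + 1 : ℕ) := by exact_mod_cast hP
  set Q : ℝ := ((n + 1 : ℕ) : ℝ)
  have hQ0 : 0 < Q := by linarith
  set l := Real.log Q with hl
  have hl2 : 0.69 ≤ l := by
    have := Real.log_le_log two_pos hP2
    linarith [Real.log_two_gt_d9]
  have hl0 : 0 < l := by linarith
  -- Here $e^t=Q/l$; the $1/l$ cancels the $O(l)$ bound on $1/(1-m(1+\theta))$.
  set t := l - Real.log l with ht
  have ht0 : 0 ≤ t := by linarith [Real.log_le_sub_one_of_pos hl0]
  have ht4 : 1 + t ≤ 4 * l := by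
    have h1 := Real.one_sub_inv_le_log_of_pos hl0
    have h2 : l⁻¹ ≤ 3 * l := by
      rw [inv_le_iff_one_le_mul₀ hl0]
      nlinarith
    linarith
  -- This keeps $\theta t\le 1$, so the extra exponent costs only a factor $e$.
  set θ := δ / (1 + t) with hθ
  have hθt : θ * (1 + t) = δ := div_mul_cancel₀ _ (by linarith)
  have hθ0 : 0 < θ := by positivity
  have hθδ : θ ≤ δ := div_le_self hδ0.le (by linarith)
  have hm := hβ.powerMoment_le hθ0.le
  rw [← hμ, ← hN] at hm
  have hm' : θ * μ / 2 ≤ 1 - powerMoment ℙ β (1 + θ) := by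
    have h1 : 4 * N * θ ≤ μ := (mul_le_mul_of_nonneg_left hθδ (by positivity)).trans hδμ
    nlinarith
  have hθμ : 0 < θ * μ / 2 := by positivity
  have hmain := hβ.mul_sub_integral_kthValue_le n hθ0.le (by linarith) t
  have hexp : Real.exp ((1 + θ) * t) ≤ Real.exp 1 * (Q / l) := by
    have h1 : Q / l = Real.exp t := by
      rw [ht, Real.exp_sub, Real.exp_log hl0, hl, Real.exp_log hQ0]
    rw [h1, ← Real.exp_add, Real.exp_le_exp]
    nlinarith
  have hinv : (1 - powerMoment ℙ β (1 + θ))⁻¹ ≤ 8 * l / (δ * μ) := by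
    refine (inv_anti₀ hθμ hm').trans ?_
    rw [inv_le_iff_one_le_mul₀ hθμ, hθ]
    have : 8 * l / (δ * μ) * (δ / (1 + t) * μ / 2) = 4 * l / (1 + t) := by
      field_simp
      ring
    rw [this, le_div_iff₀ (by linarith)]
    linarith
  have hprod := hmain.trans (mul_le_mul hexp hinv (inv_nonneg.2 (by linarith)) (by positivity))
  have heq : Real.exp 1 * (Q / l) * (8 * l / (δ * μ)) = Q * (8 * Real.exp 1 / (δ * μ)) := by
    field_simp
  rw [heq] at hprod
  have := le_of_mul_le_mul_left hprod hQ0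
  linarith

theorem IsIIDTokenTree.exists_expectedTokens_le (hβ : IsIIDTokenTree ℙ β)
    {D : ℕ → TokenTree V → Finset (List V)} (hD : ∀ P : ℕ, 1 ≤ P → IsOptimalDrafter P (D P))
    {a : ℝ} (ha : 0 < a) (haμ : a < expectedEntropy ℙ β) :
    ∃ C : ℝ, ∀ P : ℕ, 1 ≤ P → expectedTokens ℙ β (D P) ≤ Real.log P / a + C := by
  set N : ℝ := (Fintype.card V : ℝ) with hN
  have hN0 : 0 ≤ N := Nat.cast_nonneg _
  -- Small enough that $1-\theta\mu+2N\theta^2\le 1-\theta a$.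
  set θ := (expectedEntropy ℙ β - a) / (2 * N + 1) with hθ
  have hθ0 : 0 < θ := div_pos (by linarith) (by linarith)
  have hθN : 2 * N * θ ≤ expectedEntropy ℙ β - a := by
    have : θ * (2 * N + 1) = expectedEntropy ℙ β - a := div_mul_cancel₀ _ (by positivity)
    nlinarith
  have hθa : 0 < θ * a := mul_pos hθ0 ha
  have hm : powerMoment ℙ β (1 + θ) ≤ 1 - θ * a := by
    have := hβ.powerMoment_le hθ0.le
    rw [← hN] at this
    nlinarith
  -- The 2 is the rounding of `K` plus the 1 in `expectedTokens_le`; the rest bounds the geometric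
  -- tail.
  refine ⟨2 + (θ * a)⁻¹, fun P hP => ?_⟩
  obtain ⟨n, rfl⟩ : ∃ n, P = n + 1 := ⟨P - 1, by omega⟩
  have hQ : (1 : ℝ) ≤ (n + 1 : ℕ) := by exact_mod_cast hP
  set Q : ℝ := ((n + 1 : ℕ) : ℝ)
  have hlog : 0 ≤ Real.log Q / a := div_nonneg (Real.log_nonneg hQ) ha.le
  set K := ⌈Real.log Q / a⌉₊
  have hK1 : (K : ℝ) < Real.log Q / a + 1 := Nat.ceil_lt_add_one hlog
  have hK2 : Real.log Q ≤ K * a := (div_le_iff₀ ha).1 (Nat.le_ceil _)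
  -- At most $e^{\theta(\log Q-aK)}$, and $K\ge(\log Q)/a$.
  have hpow : Q ^ θ * powerMoment ℙ β (1 + θ) ^ K ≤ 1 := by
    have h1 : powerMoment ℙ β (1 + θ) ^ K ≤ Real.exp (K * -(θ * a)) := by
      rw [Real.exp_nat_mul]
      refine pow_le_pow_left₀ (powerMoment_nonneg _) (hm.trans ?_) K
      linarith [Real.add_one_le_exp (-(θ * a))]
    refine (mul_le_mul_of_nonneg_left h1 (by positivity)).trans ?_
    rw [Real.rpow_def_of_pos (by linarith), ← Real.exp_add, Real.exp_le_one_iff]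
    nlinarith
  have hinv : (1 - powerMoment ℙ β (1 + θ))⁻¹ ≤ (θ * a)⁻¹ := inv_anti₀ hθa (by linarith)
  have hmain := hβ.expectedTokens_le (hD (n + 1) hP) K hθ0.le (by linarith)
  rw [← mul_assoc] at hmain
  have := mul_le_mul hpow hinv (inv_nonneg.2 (by linarith)) zero_le_one
  linarith

theorem IsIIDTokenTree.integral_kthValue_div_le (hβ : IsIIDTokenTree ℙ β)
    {D : ℕ → TokenTree V → Finset (List V)} (hD : ∀ P : ℕ, 1 ≤ P → IsOptimalDrafter P (D P))
    (P : ℕ) (hP : 1 ≤ P) :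
    (∫ ω, kthValue P (fun v => β v ω) ∂ℙ) / expectedEntropy ℙ β ≤
      expectedTokens ℙ β (D P) := by
  obtain ⟨n, rfl⟩ : ∃ n, P = n + 1 := ⟨P - 1, by omega⟩
  rw [div_le_iff₀ hβ.expectedEntropy_pos]
  exact hβ.integral_kthValue_le (hD _ hP)

theorem IsIIDTokenTree.isEquivalent_expectedTokens (hβ : IsIIDTokenTree ℙ β)
    {D : ℕ → TokenTree V → Finset (List V)} (hD : ∀ P : ℕ, 1 ≤ P → IsOptimalDrafter P (D P)) :
    Asymptotics.IsEquivalent Filter.atTop (fun P : ℕ => expectedTokens ℙ β (D P))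
      (fun P : ℕ => Real.log P / expectedEntropy ℙ β) := by
  set μ := expectedEntropy ℙ β
  have hμ : 0 < μ := hβ.expectedEntropy_pos
  have hlog : Filter.Tendsto (fun P : ℕ => Real.log P) Filter.atTop Filter.atTop :=
    Real.tendsto_log_atTop.comp tendsto_natCast_atTop_atTop
  have hpos : ∀ᶠ P : ℕ in Filter.atTop, 0 < Real.log P := hlog.eventually_gt_atTop 0
  rw [Asymptotics.isEquivalent_iff_tendsto_one (hpos.mono fun P h => (div_pos h hμ).ne')]
  have hconst (c : ℝ) : Filter.Tendsto (fun P : ℕ => c / Real.log P) Filter.atTop (nhds 0) :=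
    hlog.const_div_atTop c
  refine tendsto_order.2 ⟨fun b hb => ?_, fun b hb => ?_⟩
  · obtain ⟨C, hC⟩ := hβ.exists_log_sub_le
    have hloglog : Filter.Tendsto (fun P : ℕ => Real.log (Real.log P) / Real.log P)
        Filter.atTop (nhds 0) :=
      Real.isLittleO_log_id_atTop.tendsto_div_nhds_zero.comp hlog
    have hlim : Filter.Tendsto
        (fun P : ℕ => 1 - Real.log (Real.log P) / Real.log P - C / Real.log P)
        Filter.atTop (nhds 1) := by
      simpa using (tendsto_const_nhds.sub hloglog).sub (hconst C)
    filter_upwards [hlim.eventually_const_lt hb, hpos, Filter.eventually_ge_atTop 2]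
      with P h1 h2 h3
    refine h1.trans_le ?_
    have h4 := hβ.integral_kthValue_div_le hD P (by omega)
    have h5 := (div_le_div_of_nonneg_right (hC P h3) hμ.le).trans h4
    simp only [Pi.div_apply]
    rw [le_div_iff₀ (div_pos h2 hμ)]
    refine le_trans (le_of_eq ?_) h5
    field_simp
  -- Any `c` strictly between 1 and `b` leaves room for the additive constant, which vanishes after
  -- division by $\log P$.
  · set c := (1 + b) / 2 with hc
    have hc1 : 1 < c := by linarith
    obtain ⟨C, hC⟩ := hβ.exists_expectedTokens_le hD (a := μ / c) (by positivity)
      (div_lt_self hμ hc1)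
    have hlim : Filter.Tendsto (fun P : ℕ => c + C * μ / Real.log P)
        Filter.atTop (nhds c) := by
      simpa using tendsto_const_nhds.add (hconst (C * μ))
    filter_upwards [hlim.eventually_lt_const (show c < b by linarith), hpos,
      Filter.eventually_ge_atTop 1] with P h1 h2 h3
    refine lt_of_le_of_lt ?_ h1
    simp only [Pi.div_apply]
    rw [div_le_iff₀ (div_pos h2 hμ)]
    refine (hC P h3).trans (le_of_eq ?_)
    field_simp

end Bounds

theorem mainTheorem3 {V Ω : Type*} [Fintype V] [DecidableEq V] [MeasurableSpace Ω]
    (ℙ : MeasureTheory.Measure Ω) [MeasureTheory.IsProbabilityMeasure ℙ]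
    (β : List V → Ω → stdSimplex ℝ V) (hβ : IsIIDTokenTree ℙ β)
    (D : ℕ → TokenTree V → Finset (List V)) (hD : ∀ P : ℕ, 1 ≤ P → IsOptimalDrafter P (D P)) :
    Asymptotics.IsEquivalent Filter.atTop
        (fun P : ℕ => expectedTokens ℙ β (D P))
        (fun P : ℕ => Real.log P / expectedEntropy ℙ β) ∧
      (∀ P : ℕ, 1 ≤ P →
        (∫ ω, kthValue P (fun v => β v ω) ∂ℙ) / expectedEntropy ℙ β ≤
          expectedTokens ℙ β (D P)) ∧
      ∃ C : ℝ, ∀ P : ℕ, 2 ≤ P →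
        Real.log P - Real.log (Real.log P) - C ≤ ∫ ω, kthValue P (fun v => β v ω) ∂ℙ :=
  ⟨hβ.isEquivalent_expectedTokens hD, hβ.integral_kthValue_div_le hD, hβ.exists_log_sub_le⟩
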